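/- Let $n\ge 0$ be an integer, $q=e^{2\pi\sqrt{-1}\,\tau}$ with $\operatorname{Im}\tau>0$, and let $\beta_1,\beta_2,\gamma\in\mathbb C$, $x_1,x_2\in\mathbb C\setminus\{0\}$; put $q^z:=e^{2\pi\sqrt{-1}\,\tau z}$, $x:=x_2/x_1$ and $(y;c)_\nu:=\prod_{i=0}^{\nu-1}(1-c^iy)$. For $0\le s\le n$ let $$\varphi_s(t)=\mathcal A\Bigl[\prod_{k=1}^n\frac{1}{1-t_k/x_2}\prod_{k=1}^{n-s}\frac{1-q^{\beta_2}t_k/x_2}{1-t_k/x_1}\prod_{1\le i<j\le n}(t_i-q^{-\gamma}t_j)\Bigr],$$ where $\mathcal A g=\sum_{\sigma\in\mathfrak S_n}\operatorname{sgn}\sigma\cdot\sigma g$ is the alternating sum over permutations of $t=(t_1,\ldots,t_n)$, and let $\psi_s$ be obtained from $\varphi_s$ by exchanging $x_1,\beta_1$ with $x_2,\beta_2$. Assume that the parameters are generic in the following sense: $q^{k\gamma}\ne1$ for $1\le k\le n$; $x\ne q^{k\gamma}$ for all integers $k$ with $|k|\le n-1$; and $x\ne q^{\beta_2+k\gamma}$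 for $0\le k\le n-1$. Then there is exactly one complex matrix $R_{2,1}(x)$ of order $n+1$, not depending on $t$, with $$(\varphi_0(t),\varphi_1(t),\ldots,\varphi_n(t))\,R_{2,1}(x)=(\psi_n(t),\psi_{n-1}(t),\ldots,\psi_0(t))$$ as rational functions of $t$, and it admits the Gauss decomposition $$R_{2,1}(x)=L'_R\cdot D'_R\cdot U'_R .$$ Here the rows and columns are indexed by $0\le r,s\le n$; $L'_R=(l'_{rs})$ is lower unitriangular with, for $r\ge s$, $$l'_{rs}=(-1)^{r-s}q^{-(r-s)(2n-r-s-1)\gamma/2}\,\frac{(q^\gamma;q^\gamma)_{n-s}}{(q^\gamma;q^\gamma)_{r-s}(q^\gamma;q^\gamma)_{n-r}}\cdot\frac{(q^{\beta_2+s\gamma};q^\gamma)_{r-s}}{(x\,q^{-(n-2s-1)\gamma};q^\gamma)_{r-s}};$$ $D'_R=\operatorname{diag}[d'_0,\ldots,d'_n]$ with $$d'_r=q^{-(n-r)(\beta_2+r\gamma)}\,\frac{(x\,q^{\beta_1};q^\gamma)_r}{(x\,q^{-\beta_2-(n-r-1)\gamma};q^\gamma)_{n-r}}\cdot\frac{(x\,q^{-(n-2r-1)\gamma};q^\gamma)_{n-r}}{(x\,q^{-(n-r)\gamma};q^\gamma)_r};$$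 and $U'_R=(u'_{rs})$ is upper unitriangular with, for $s\ge r$, $$u'_{rs}=q^{-(s-r)r\gamma}\,\frac{(q^\gamma;q^\gamma)_s}{(q^\gamma;q^\gamma)_{s-r}(q^\gamma;q^\gamma)_r}\cdot\frac{(q^{\beta_1+(n-s)\gamma};q^\gamma)_{s-r}}{(x^{-1}q^{(n-r-s)\gamma};q^\gamma)_{s-r}} .$$ -/

import Mathlib

/-- The power `q ^ z` with `q = exp (2πiτ)`, that is `exp (2πiτz)`, for `z` complex. -/
noncomputable def qpow (τ z : ℂ) : ℂ :=
  Complex.exp (2 * (Real.pi : ℂ) * Complex.I * τ * z)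

/-- The finite Pochhammer product
`(x ; c)_ν = (1 - x) (1 - c x) ⋯ (1 - c ^ (ν - 1) x)`. -/
noncomputable def qPoch (x c : ℂ) (ν : ℕ) : ℂ :=
  ∏ i ∈ Finset.range ν, (1 - c ^ i * x)

/-- The alternating sum `𝒜 g (t) = ∑ σ, sgn σ · g (t_σ(1), …, t_σ(n))`. -/
noncomputable def altSum {n : ℕ} (g : (Fin n → ℂ) → ℂ) (t : Fin n → ℂ) : ℂ :=
  ∑ σ : Equiv.Perm (Fin n), ((Equiv.Perm.sign σ : ℤ) : ℂ) * g (fun k => t (σ k))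

/-- Matsuo's rational function `ψ_(s, n-s) [x, y; β, β'] (t)` in `n` variables for two points
`x, y`. The parameter `β'` belonging to the second point `y` does not occur in it. -/
noncomputable def matsuo (τ γ : ℂ) (n : ℕ) (x y β : ℂ) (s : ℕ) (t : Fin n → ℂ) : ℂ :=
  altSum (fun t : Fin n → ℂ =>
    (∏ k : Fin n, 1 / (1 - t k / x)) *
    (∏ k : Fin n with k.val < n - s, (1 - qpow τ β * t k / x) / (1 - t k / y)) *
    (∏ i : Fin n, ∏ j : Fin n with i < j, (t i - qpow τ (-γ) * t j))) t

/-- `R` is a matrix `R_{2,1}(x₂/x₁)` : it is constant in `t`, and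
`(φ_0, φ_1, …, φ_n) R = (ψ_n, ψ_{n-1}, …, ψ_0)`
as an identity of rational functions of `t`, where `ψ_s = ψ_(s, n-s) [x₁, x₂; β₁, β₂]` and
`φ_s = ψ_(s, n-s) [x₂, x₁; β₂, β₁]`. -/
def IsRMatrix21 (τ γ : ℂ) (n : ℕ) (x₁ x₂ β₁ β₂ : ℂ)
    (R : Matrix (Fin (n + 1)) (Fin (n + 1)) ℂ) : Prop :=
  ∀ t : Fin n → ℂ, (∀ k, t k ≠ x₁ ∧ t k ≠ x₂) →
    Matrix.vecMul (fun s : Fin (n + 1) => matsuo τ γ n x₂ x₁ β₂ s.val t) R =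
      fun s : Fin (n + 1) => matsuo τ γ n x₁ x₂ β₁ (n - s.val) t

/-- The lower triangular factor, with `x = x₂/x₁`. -/
noncomputable def gaussL' (τ γ : ℂ) (n : ℕ) (x β₂ : ℂ) :
    Matrix (Fin (n + 1)) (Fin (n + 1)) ℂ :=
  Matrix.of fun r' s' : Fin (n + 1) =>
    let r : ℕ := r'.val
    let s : ℕ := s'.val
    let c : ℂ := qpow τ γ
    if s ≤ r then
      (-1) ^ (r - s) *
        qpow τ (-(((r : ℂ) - s) * (2 * (n : ℂ) - r - s - 1) * γ / 2)) *
        (qPoch c c (n - s) / (qPoch c c (r - s) * qPoch c c (n - r))) *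
        (qPoch (qpow τ (β₂ + s * γ)) c (r - s) /
          qPoch (x * qpow τ (-(((n : ℂ) - 2 * s - 1) * γ))) c (r - s))
    else 0

/-- The diagonal factor, with `x = x₂/x₁`. -/
noncomputable def gaussD' (τ γ : ℂ) (n : ℕ) (x β₁ β₂ : ℂ) :
    Matrix (Fin (n + 1)) (Fin (n + 1)) ℂ :=
  Matrix.diagonal fun r' : Fin (n + 1) =>
    let r : ℕ := r'.val
    let c : ℂ := qpow τ γ
    qpow τ (-(((n : ℂ) - r) * (β₂ + r * γ))) *
      (qPoch (x * qpow τ β₁) c r /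
        qPoch (x * qpow τ (-β₂ - ((n : ℂ) - r - 1) * γ)) c (n - r)) *
      (qPoch (x * qpow τ (-(((n : ℂ) - 2 * r - 1) * γ))) c (n - r) /
        qPoch (x * qpow τ (-(((n : ℂ) - r) * γ))) c r)

/-- The upper triangular factor, with `x = x₂/x₁` (so that `x⁻¹ = x₁/x₂`). -/
noncomputable def gaussU' (τ γ : ℂ) (n : ℕ) (x β₁ : ℂ) :
    Matrix (Fin (n + 1)) (Fin (n + 1)) ℂ :=
  Matrix.of fun r' s' : Fin (n + 1) =>
    let r : ℕ := r'.val
    let s : ℕ := s'.val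
    let c : ℂ := qpow τ γ
    if r ≤ s then
      qpow τ (-(((s : ℂ) - r) * r * γ)) *
        (qPoch c c s / (qPoch c c (s - r) * qPoch c c r)) *
        (qPoch (qpow τ (β₁ + ((n : ℂ) - s) * γ)) c (s - r) /
          qPoch (x⁻¹ * qpow τ (((n : ℂ) - r - s) * γ)) c (s - r))
    else 0

/-! Put `a = q^γ`. After clearing the common denominator `∏ (1 - t_k/x₁)(1 - t_k/x₂)`, every `φ_s`
and `ψ_s` becomes an alternating polynomial of degree at most `n` in each variable. Such polynomials
are combinations of the `n + 1` alternants that omit one exponent from `0, …, n`. They are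
determined by their values on the progressions `t_i = z a^(n-1-i)`: there the alternants become
distinct powers of `z` with nonzero Vandermonde coefficients.

On such a progression only the identity permutation survives in the numerators, because of the
factors `t_i - a⁻¹ t_j`. With `w = z/x₁`, `x = x₂/x₁` and a common factor removed, the relation
becomes one between polynomials in `w` (`isRMatrix21_iff`): `(w;a)_r (a^r q^β₂ w/x;a)_(n-r)` must be
carried to `(w/x;a)_(n-s) (a^(n-s) q^β₁ w;a)_s`.

The Gauss factors pass through the intermediate basis `(w;a)_r (w/x;a)_(n-r)`. The lower factor
reaches it up to scalars by a `q`-Saalschütz sum (`sum_saalschutz`), the diagonal factor rescales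
it, and the upper factor leads to the target by interpolation (`sum_interpolation`). Uniqueness is
linear independence of the source family, seen by evaluating at `w = a^(-r)`. -/

/-! ### Pochhammer products and Gaussian binomials -/

theorem qPoch_zero (x c : ℂ) : qPoch x c 0 = 1 := by simp [qPoch]

theorem qPoch_succ (x c : ℂ) (m : ℕ) : qPoch x c (m + 1) = qPoch x c m * (1 - c ^ m * x) := by
  simp [qPoch, Finset.prod_range_succ]

theorem qPoch_add (x c : ℂ) (m k : ℕ) :
    qPoch x c (m + k) = qPoch x c m * qPoch (c ^ m * x) c k := by
  simp only [qPoch, Finset.prod_range_add]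
  congr 1
  refine Finset.prod_congr rfl fun i _ => ?_
  ring

theorem qPoch_succ_left (x c : ℂ) (m : ℕ) :
    qPoch x c (m + 1) = (1 - x) * qPoch (c * x) c m := by
  rw [add_comm, qPoch_add, pow_one]
  simp [qPoch]

theorem qPoch_ne_zero {x c : ℂ} {m : ℕ} (h : ∀ i < m, c ^ i * x ≠ 1) : qPoch x c m ≠ 0 := by
  refine Finset.prod_ne_zero_iff.2 fun i hi => ?_
  exact sub_ne_zero.2 (h i (Finset.mem_range.1 hi)).symm

/-- The Gaussian binomial coefficient `[j + k choose j]` as a quotient of Pochhammer products. -/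
noncomputable def gaussBinom (a : ℂ) (j k : ℕ) : ℂ :=
  qPoch a a (j + k) / (qPoch a a j * qPoch a a k)

theorem gaussBinom_zero_left {a : ℂ} {k : ℕ} (h : qPoch a a k ≠ 0) : gaussBinom a 0 k = 1 := by
  simp [gaussBinom, qPoch_zero, h]

theorem gaussBinom_zero_right {a : ℂ} {j : ℕ} (h : qPoch a a j ≠ 0) : gaussBinom a j 0 = 1 := by
  simp [gaussBinom, qPoch_zero, h]

/-- The three entries of a Pascal triangle share the factor `u`. This reduces both `q`-Pascal rules,
and any weighted variant, to polynomial identities. -/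
theorem exists_gaussBinom_succ {a : ℂ} {j k : ℕ} (h : ∀ i ≤ j + k + 1, qPoch a a i ≠ 0) :
    ∃ u : ℂ, gaussBinom a (j + 1) k = u * (1 - a ^ (k + 1)) ∧
      gaussBinom a j (k + 1) = u * (1 - a ^ (j + 1)) ∧
      gaussBinom a (j + 1) (k + 1) = u * (1 - a ^ (j + k + 2)) := by
  have hj := h (j + 1) (by omega)
  have hk := h (k + 1) (by omega)
  refine ⟨qPoch a a (j + k + 1) / (qPoch a a (j + 1) * qPoch a a (k + 1)), ?_, ?_, ?_⟩
  · rw [gaussBinom, show j + 1 + k = j + k + 1 by ring]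
    rw [qPoch_succ a a k] at hk ⊢
    have := left_ne_zero_of_mul hk
    have := right_ne_zero_of_mul hk
    rw [pow_succ]
    field_simp
  · rw [gaussBinom, show j + (k + 1) = j + k + 1 by ring]
    rw [qPoch_succ a a j] at hj ⊢
    have := left_ne_zero_of_mul hj
    have := right_ne_zero_of_mul hj
    rw [pow_succ]
    field_simp
  · rw [gaussBinom, show j + 1 + (k + 1) = j + k + 1 + 1 by ring, qPoch_succ a a (j + k + 1)]
    rw [show j + k + 2 = j + k + 1 + 1 by ring, pow_succ a (j + k + 1)]
    ring

/-! ### Summation over antidiagonals and the `q`-Saalschütz identity -/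

/-- The induction step of a Pascal-type proof: each term of level `m + 1` splits into contributions
of its two neighbours of level `m`, and regrouping by the neighbour gives the right-hand side. -/
theorem sum_antidiagonal_succ_of_rec (T P Q : ℕ → ℕ → ℂ) (m : ℕ)
    (h : ∀ j k, j + k + 1 = m → T (j + 1) (k + 1) = P (j + 1) k + Q j (k + 1))
    (hl : T 0 (m + 1) = P 0 m) (hr : T (m + 1) 0 = Q m 0) :
    ∑ p ∈ Finset.HasAntidiagonal.antidiagonal (m + 1), T p.1 p.2 =
      ∑ p ∈ Finset.HasAntidiagonal.antidiagonal m, (P p.1 p.2 + Q p.1 p.2) := by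
  rw [Finset.sum_add_distrib]
  cases m with
  | zero => simp [Finset.Nat.antidiagonal_succ, hl, hr]
  | succ m =>
    rw [Finset.Nat.sum_antidiagonal_succ, Finset.Nat.sum_antidiagonal_succ' (n := m)
      (f := fun p => T (p.1 + 1) p.2), Finset.Nat.sum_antidiagonal_succ (f := fun p => P p.1 p.2),
      Finset.Nat.sum_antidiagonal_succ' (f := fun p => Q p.1 p.2)]
    have : ∑ p ∈ Finset.HasAntidiagonal.antidiagonal m, T (p.1 + 1) (p.2 + 1) =
        ∑ p ∈ Finset.HasAntidiagonal.antidiagonal m, (P (p.1 + 1) p.2 + Q p.1 (p.2 + 1)) :=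
      Finset.sum_congr rfl fun p hp => h _ _ (by rw [Finset.HasAntidiagonal.mem_antidiagonal.1 hp])
    simp only [this, Finset.sum_add_distrib, hl, hr]
    ring

/-- A polynomial form of the `q`-Saalschütz summation. -/
theorem sum_saalschutz (a B X y : ℂ) (m : ℕ) (ha : ∀ i ≤ m, qPoch a a i ≠ 0) :
    ∑ p ∈ Finset.HasAntidiagonal.antidiagonal m, gaussBinom a p.1 p.2 * qPoch B a p.1 *
        qPoch (B * a ^ p.1 * y) a p.2 * qPoch (X * y) a p.1 * ∏ i ∈ Finset.range p.2, (X - a ^ i) =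
      (∏ i ∈ Finset.range m, (X - B * a ^ i)) * qPoch y a m := by
  induction m with
  | zero => simp [qPoch, gaussBinom]
  | succ m ih =>
    -- The multipliers of the level `m` term are chosen so that, for `j + k = m`, they add up to `(X
    -- - B a^m)(1 - a^m y)`, the new factor on the right.
    rw [sum_antidiagonal_succ_of_rec (fun j k => gaussBinom a j k * qPoch B a j *
        qPoch (B * a ^ j * y) a k * qPoch (X * y) a j * ∏ i ∈ Finset.range k, (X - a ^ i))
      (fun j k => (X - a ^ k) * (1 - B * y * a ^ (2 * j + k)) * (gaussBinom a j k * qPoch B a j *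
        qPoch (B * a ^ j * y) a k * qPoch (X * y) a j * ∏ i ∈ Finset.range k, (X - a ^ i)))
      (fun j k => a ^ k * (1 - B * a ^ j) * (1 - X * y * a ^ j) * (gaussBinom a j k * qPoch B a j *
        qPoch (B * a ^ j * y) a k * qPoch (X * y) a j * ∏ i ∈ Finset.range k, (X - a ^ i)))]
    · rw [Finset.prod_range_succ, qPoch_succ, mul_mul_mul_comm, ← ih fun i hi => ha i (by omega),
        Finset.sum_mul]
      refine Finset.sum_congr rfl fun p hp => ?_
      rw [← Finset.HasAntidiagonal.mem_antidiagonal.1 hp]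
      ring
    · intro j k hjk
      obtain ⟨u, h1, h2, h3⟩ := exists_gaussBinom_succ (a := a) (j := j) (k := k)
        fun i hi => ha i (by omega)
      simp only [h1, h2, h3]
      rw [qPoch_succ_left (B * a ^ j * y) a k, qPoch_succ (B * a ^ (j + 1) * y) a k,
        qPoch_succ B, qPoch_succ (X * y), Finset.prod_range_succ,
        show a * (B * a ^ j * y) = B * a ^ (j + 1) * y by ring]
      ring
    · simp only [gaussBinom_zero_left (ha m (by omega)), gaussBinom_zero_left (ha (m + 1) le_rfl),
        Finset.prod_range_succ, qPoch_succ, qPoch_zero]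
      ring
    · simp only [gaussBinom_zero_right (ha m (by omega)), gaussBinom_zero_right (ha (m + 1) le_rfl),
        Finset.prod_range_zero, qPoch_succ, qPoch_zero]
      ring

/-! ### Interpolation by products of two Pochhammer symbols -/

/-- The weights of the interpolation identity `sum_interpolation`. -/
noncomputable def interpWeight (a Y : ℂ) (r k : ℕ) : ℂ :=
  a ^ (r * k) * Y ^ k * gaussBinom a r k /
    ((∏ i ∈ Finset.range r, (a ^ k - Y * a ^ i)) * ∏ i ∈ Finset.range k, (Y * a ^ r - a ^ i))

theorem interpWeight_zero_left {a Y : ℂ} {k : ℕ} (h : qPoch a a k ≠ 0) :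
    interpWeight a Y 0 k = Y ^ k / ∏ i ∈ Finset.range k, (Y - a ^ i) := by
  simp [interpWeight, gaussBinom_zero_left h]

theorem interpWeight_zero_right {a Y : ℂ} {r : ℕ} (h : qPoch a a r ≠ 0) :
    interpWeight a Y r 0 = 1 / ∏ i ∈ Finset.range r, (1 - Y * a ^ i) := by
  simp [interpWeight, gaussBinom_zero_right h]

theorem prod_range_succ_sub_pow (a b Y : ℂ) (r : ℕ) :
    ∏ i ∈ Finset.range (r + 1), (a * b - Y * a ^ i) =
      (a * b - Y) * (a ^ r * ∏ i ∈ Finset.range r, (b - Y * a ^ i)) := by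
  rw [Finset.prod_range_succ', mul_comm, pow_zero, mul_one]
  congr 1
  rw [← Finset.card_range r, ← Finset.prod_const, Finset.card_range, ← Finset.prod_mul_distrib]
  exact Finset.prod_congr rfl fun i _ => by ring

/-- The Pascal rule of the weights. Its coefficients are those of linear Lagrange interpolation in
`sum_interpolation`, without the factors involving `b`. -/
theorem interpWeight_succ_succ {a Y : ℂ} (ha0 : a ≠ 0) (r k : ℕ)
    (ha : ∀ i ≤ r + k + 1, qPoch a a i ≠ 0)
    (hY : ∀ i j, i < r + k + 2 → j < r + k + 2 → Y * a ^ i ≠ a ^ j) :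
    interpWeight a Y (r + 1) (k + 1) =
      Y * a ^ (r + 1) / (Y * a ^ (r + 1) - a ^ k) * interpWeight a Y (r + 1) k +
      a ^ (k + 1) / (a ^ (k + 1) - Y * a ^ r) * interpWeight a Y r (k + 1) := by
  obtain ⟨u, h1, h2, h3⟩ := exists_gaussBinom_succ ha
  have e1 := prod_range_succ_sub_pow a (a ^ k) Y r
  have e2 : ∏ i ∈ Finset.range (k + 1), (Y * a ^ (r + 1) - a ^ i) =
      (Y * a ^ (r + 1) - 1) * (a ^ k * ∏ i ∈ Finset.range k, (Y * a ^ r - a ^ i)) := by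
    have := prod_range_succ_sub_pow a (Y * a ^ r) 1 k
    simpa only [one_mul, pow_succ', mul_left_comm a Y] using this
  have n1 : a * a ^ k - Y ≠ 0 := by
    have := hY 0 (k + 1) (by omega) (by omega)
    rw [pow_zero, mul_one, pow_succ'] at this
    exact sub_ne_zero.2 this.symm
  have n2 : Y * a ^ (r + 1) - 1 ≠ 0 := by
    simpa [sub_ne_zero] using hY (r + 1) 0 (by omega) (by omega)
  have n3 : a ^ k - Y * a ^ r ≠ 0 := sub_ne_zero.2 (hY r k (by omega) (by omega)).symm
  have n4 : Y * a ^ (r + 1) - a ^ k ≠ 0 := sub_ne_zero.2 (hY (r + 1) k (by omega) (by omega))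
  have n5 : a * a ^ k - Y * a ^ r ≠ 0 := by
    have := hY r (k + 1) (by omega) (by omega)
    rw [pow_succ' a k] at this
    exact sub_ne_zero.2 this.symm
  have hE : ∏ i ∈ Finset.range r, (a ^ k - Y * a ^ i) ≠ 0 :=
    Finset.prod_ne_zero_iff.2 fun i hi =>
      sub_ne_zero.2 (hY i k (by have := Finset.mem_range.1 hi; omega) (by omega)).symm
  have hF : ∏ i ∈ Finset.range k, (Y * a ^ r - a ^ i) ≠ 0 :=
    Finset.prod_ne_zero_iff.2 fun i hi =>
      sub_ne_zero.2 (hY r i (by omega) (by have := Finset.mem_range.1 hi; omega))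
  have f1 : ∏ i ∈ Finset.range k, (Y * a ^ (r + 1) - a ^ i) =
      (Y * a ^ (r + 1) - 1) * (a ^ k * ∏ i ∈ Finset.range k, (Y * a ^ r - a ^ i)) /
        (Y * a ^ (r + 1) - a ^ k) := by
    rw [← e2, Finset.prod_range_succ, mul_div_cancel_right₀ _ n4]
  have f2 : ∏ i ∈ Finset.range r, (a * a ^ k - Y * a ^ i) =
      (a * a ^ k - Y) * (a ^ r * ∏ i ∈ Finset.range r, (a ^ k - Y * a ^ i)) /
        (a * a ^ k - Y * a ^ r) := by
    rw [← e1, Finset.prod_range_succ, mul_div_cancel_right₀ _ n5]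
  simp only [interpWeight, h1, h2, h3]
  rw [e2, f1, pow_succ' a k, e1, f2, Finset.prod_range_succ, Finset.prod_range_succ]
  generalize ∏ i ∈ Finset.range r, (a ^ k - Y * a ^ i) = E at hE
  generalize ∏ i ∈ Finset.range k, (Y * a ^ r - a ^ i) = F at hF
  have n3' : Y * a ^ r - a ^ k ≠ 0 := by rw [← neg_sub]; exact neg_ne_zero.2 n3
  have hk : a ^ k ≠ 0 := pow_ne_zero _ ha0
  have hr : a ^ r ≠ 0 := pow_ne_zero _ ha0
  rw [show a ^ ((r + 1) * (k + 1)) = a ^ (r * k) * a ^ r * a ^ k * a by ring,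
    show a ^ ((r + 1) * k) = a ^ (r * k) * a ^ k by ring,
    show a ^ (r * (k + 1)) = a ^ (r * k) * a ^ r by ring,
    show a ^ (r + k + 2) = a ^ r * a ^ k * a ^ 2 by ring]
  rw [pow_succ a r, ← mul_assoc] at n2 n4
  rw [pow_succ a r, ← mul_assoc Y (a ^ r) a]
  rw [pow_succ Y k]
  generalize a ^ (r * k) = S
  generalize Y ^ k = Z
  generalize a ^ r = x at *
  generalize a ^ k = z at *
  -- Once the common factor `S Z Y u / (E F)` is taken out, the recurrence is this partial fraction
  -- identity.
  have key : a * (1 - x * z * a ^ 2) / ((a * z - Y) * (Y * x * a - 1)) =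
      a * x * (1 - a * z) / ((z - Y * x) * (Y * x * a - 1)) -
        a * z * (1 - x * a) / ((a * z - Y) * (z - Y * x)) := by
    rw [div_sub_div _ _ (mul_ne_zero n3 n2) (mul_ne_zero n1 n3),
      div_eq_div_iff (mul_ne_zero n1 n2) (mul_ne_zero (mul_ne_zero n3 n2) (mul_ne_zero n1 n3))]
    ring
  have l1 : S * x * z * a * (Z * Y) * (u * (1 - x * z * a ^ 2)) /
      ((a * z - Y) * (x * E) * ((Y * x * a - 1) * (z * F))) =
      S * Z * Y * u / (E * F) * (a * (1 - x * z * a ^ 2) / ((a * z - Y) * (Y * x * a - 1))) := by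
    field_simp
  have l2 : Y * x * a / (Y * x * a - z) * (S * z * Z * (u * (1 - a * z)) /
      (E * (z - Y * x) * ((Y * x * a - 1) * (z * F) / (Y * x * a - z)))) =
      S * Z * Y * u / (E * F) * (a * x * (1 - a * z) / ((z - Y * x) * (Y * x * a - 1))) := by
    field_simp
  have l3 : a * z / (a * z - Y * x) * (S * x * (Z * Y) * (u * (1 - x * a)) /
      ((a * z - Y) * (x * E) / (a * z - Y * x) * (F * (Y * x - z)))) =
      - (S * Z * Y * u / (E * F) * (a * z * (1 - x * a) / ((a * z - Y) * (z - Y * x)))) := by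
    rw [show z - Y * x = -(Y * x - z) by ring]
    field_simp
  rw [l1, l2, l3, key]
  ring

/-- Interpolation of `(b w ; a)_m` by the products `(w ; a)_r (w / Y ; a)_k` with `r + k = m`. -/
theorem sum_interpolation {a Y : ℂ} (ha0 : a ≠ 0) (hY0 : Y ≠ 0) (b w : ℂ) (m : ℕ)
    (ha : ∀ i ≤ m, qPoch a a i ≠ 0) (hY : ∀ i j, i < m → j < m → Y * a ^ i ≠ a ^ j) :
    ∑ p ∈ Finset.HasAntidiagonal.antidiagonal m, interpWeight a Y p.1 p.2 * qPoch w a p.1 *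
        qPoch (Y * b) a p.1 * qPoch b a p.2 * qPoch (w / Y) a p.2 = qPoch (b * w) a m := by
  induction m with
  | zero => simp [qPoch, interpWeight, gaussBinom]
  | succ m ih =>
    -- For `r + k = m`, the new factor `1 - a^m b w` is linear in `w`; the two multipliers are its
    -- Lagrange interpolation at the nodes `w = a^(-r)` and `w = Y a^(-k)`, which differ because `Y
    -- a^r ≠ a^k`.
    rw [sum_antidiagonal_succ_of_rec (fun r k => interpWeight a Y r k * qPoch w a r *
        qPoch (Y * b) a r * qPoch b a k * qPoch (w / Y) a k)
      (fun r k => Y * a ^ r * (1 - b * a ^ k) / (Y * a ^ r - a ^ k) * (1 - a ^ k * (w / Y)) *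
        (interpWeight a Y r k * qPoch w a r *
        qPoch (Y * b) a r * qPoch b a k * qPoch (w / Y) a k))
      (fun r k => a ^ k * (1 - a ^ r * (Y * b)) / (a ^ k - Y * a ^ r) * (1 - a ^ r * w) *
        (interpWeight a Y r k * qPoch w a r *
        qPoch (Y * b) a r * qPoch b a k * qPoch (w / Y) a k))]
    · rw [qPoch_succ, ← ih (fun i hi => ha i (by omega))
        (fun i j hi hj => hY i j (by omega) (by omega)), Finset.sum_mul]
      refine Finset.sum_congr rfl fun p hp => ?_
      have hp := Finset.HasAntidiagonal.mem_antidiagonal.1 hp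
      rw [← add_mul, mul_comm]
      congr 1
      have n1 : Y * a ^ p.1 - a ^ p.2 ≠ 0 :=
        sub_ne_zero.2 (hY p.1 p.2 (by omega) (by omega))
      rw [← hp, ← neg_sub (Y * a ^ p.1), pow_add]
      field_simp
      ring
    · intro r k hrk
      have := interpWeight_succ_succ (Y := Y) ha0 r k (fun i hi => ha i (by omega))
        (fun i j hi hj => hY i j (by omega) (by omega))
      rw [this]
      simp only [qPoch_succ]
      ring
    · simp only [interpWeight_zero_left (ha m (by omega)), Finset.prod_range_succ,
        interpWeight_zero_left (ha (m + 1) le_rfl), qPoch_succ, qPoch_zero,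
        div_eq_mul_inv, mul_inv]
      ring
    · simp only [interpWeight_zero_right (ha m (by omega)), Finset.prod_range_succ,
        interpWeight_zero_right (ha (m + 1) le_rfl), qPoch_succ, qPoch_zero,
        div_eq_mul_inv, mul_inv]
      ring

/-! ### Alternants and their values on geometric progressions -/

theorem altSum_prod_pow {n : ℕ} (m : Fin n → ℕ) (t : Fin n → ℂ) :
    altSum (fun t : Fin n → ℂ => ∏ k, t k ^ m k) t =
      (Matrix.of fun i j : Fin n => t i ^ m j).det := by
  simp [altSum, Matrix.det_apply, Units.smul_def]

/-- A repeated exponent makes two columns equal. Otherwise the exponents miss exactly one value `k`,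
and sorting the columns costs only a sign. -/
theorem det_pow_mem_span {n : ℕ} (m : Fin n → Fin (n + 1)) :
    (fun t : Fin n → ℂ => (Matrix.of fun i j : Fin n => t i ^ (m j : ℕ)).det) ∈
      Submodule.span ℂ (Set.range fun (k : Fin (n + 1)) (t : Fin n → ℂ) =>
        (Matrix.of fun i j : Fin n => t i ^ (k.succAbove j : ℕ)).det) := by
  by_cases hm : Function.Injective m
  · obtain ⟨k, hk⟩ : ∃ k, ∀ j, m j ≠ k := by
      by_contra! h
      have := Fintype.card_le_of_surjective m h
      simp at this
    choose σ hσ using fun j => Fin.exists_succAbove_eq (hk j)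
    have hinj : Function.Injective σ := fun i j hij => hm (by rw [← hσ i, ← hσ j, hij])
    let e : Equiv.Perm (Fin n) := Equiv.ofBijective σ (Finite.injective_iff_bijective.1 hinj)
    have : (fun t : Fin n → ℂ => (Matrix.of fun i j : Fin n => t i ^ (m j : ℕ)).det) =
        ((Equiv.Perm.sign e : ℤ) : ℂ) • fun t : Fin n → ℂ =>
          (Matrix.of fun i j : Fin n => t i ^ (k.succAbove j : ℕ)).det := by
      funext t
      rw [Pi.smul_apply, smul_eq_mul, ← Matrix.det_permute']
      congr 1
      ext i j
      simp [e, hσ]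
    rw [this]
    exact Submodule.smul_mem _ _ (Submodule.subset_span ⟨k, rfl⟩)
  · obtain ⟨i, j, hij, hne⟩ : ∃ i j, m i = m j ∧ i ≠ j := by
      simpa [Function.Injective] using hm
    have : (fun t : Fin n → ℂ => (Matrix.of fun i j : Fin n => t i ^ (m j : ℕ)).det) = 0 := by
      funext t
      exact Matrix.det_zero_of_column_eq hne fun l => by simp [hij]
    rw [this]
    exact Submodule.zero_mem _

/-- The alternating sum of a polynomial of degree at most `n` in each of its `n` variables is a
combination of the `n + 1` alternants that omit one of the exponents `0, …, n`. -/
theorem exists_altSum_eq_sum_det {n : ℕ} (G : MvPolynomial (Fin n) ℂ)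
    (hG : ∀ i, G.degreeOf i ≤ n) :
    ∃ c : Fin (n + 1) → ℂ, ∀ t, altSum (fun t => MvPolynomial.eval t G) t =
      ∑ k, c k * (Matrix.of fun i j : Fin n => t i ^ (k.succAbove j : ℕ)).det := by
  have hmem : (fun t => altSum (fun t => MvPolynomial.eval t G) t) ∈
      Submodule.span ℂ (Set.range fun (k : Fin (n + 1)) (t : Fin n → ℂ) =>
        (Matrix.of fun i j : Fin n => t i ^ (k.succAbove j : ℕ)).det) := by
    have : (fun t => altSum (fun t => MvPolynomial.eval t G) t) =
        ∑ m ∈ G.support, G.coeff m •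
          fun t : Fin n → ℂ => (Matrix.of fun i j : Fin n => t i ^ m j).det := by
      funext t
      simp only [Finset.sum_apply, Pi.smul_apply, smul_eq_mul, ← altSum_prod_pow, altSum,
        MvPolynomial.eval_eq', Finset.mul_sum]
      rw [Finset.sum_comm]
      exact Finset.sum_congr rfl fun m _ => Finset.sum_congr rfl fun σ _ => by ring
    rw [this]
    refine Submodule.sum_mem _ fun m hm => Submodule.smul_mem _ _ ?_
    have hlt : ∀ j, m j < n + 1 := fun j =>
      Nat.lt_succ_of_le ((MvPolynomial.monomial_le_degreeOf j hm).trans (hG j))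
    exact det_pow_mem_span fun j => ⟨m j, hlt j⟩
  obtain ⟨c, hc⟩ := (Submodule.mem_span_range_iff_exists_fun ℂ).1 hmem
  refine ⟨c, fun t => ?_⟩
  rw [← congrFun hc t]
  simp

/-- On a geometric progression column `j` carries the scalar `z ^ m j`, and what is left is a
transposed Vandermonde matrix with its rows reversed. -/
theorem det_pow_geometric {n : ℕ} (a z : ℂ) (m : Fin n → ℕ) :
    (Matrix.of fun i j : Fin n => (z * a ^ (i.rev : ℕ)) ^ m j).det =
      z ^ (∑ j, m j) * (((Equiv.Perm.sign (Fin.revPerm (n := n)) : ℤ) : ℂ) *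
        (Matrix.vandermonde fun j => a ^ m j).det) := by
  rw [← Matrix.det_transpose (Matrix.vandermonde _), ← Matrix.det_permute,
    ← Finset.prod_pow_eq_pow_sum, ← Matrix.det_mul_row]
  congr 1
  ext i j
  simp [Matrix.vandermonde, mul_pow, ← pow_mul, mul_comm]

/-- An alternating sum of low degree is determined by its values on geometric progressions. -/
theorem altSum_eq_zero_of_geometric {n : ℕ} {a : ℂ}
    (ha : ∀ i j : ℕ, i ≤ n → j ≤ n → a ^ i = a ^ j → i = j)
    (G : MvPolynomial (Fin n) ℂ) (hG : ∀ i, G.degreeOf i ≤ n)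
    (h : ∀ z : ℂ, altSum (fun t => MvPolynomial.eval t G) (fun i => z * a ^ (i.rev : ℕ)) = 0)
    (t : Fin n → ℂ) : altSum (fun t => MvPolynomial.eval t G) t = 0 := by
  obtain ⟨c, hc⟩ := exists_altSum_eq_sum_det G hG
  simp only [hc, det_pow_geometric] at h
  rw [hc]
  set v : Fin (n + 1) → ℂ := fun k => ((Equiv.Perm.sign (Fin.revPerm (n := n)) : ℤ) : ℂ) *
    (Matrix.vandermonde fun j => a ^ (k.succAbove j : ℕ)).det with hv
  have hv0 : ∀ k, v k ≠ 0 := by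
    intro k
    refine mul_ne_zero (by simp) (Matrix.det_vandermonde_ne_zero_iff.2 fun i j hij => ?_)
    exact Fin.succAbove_right_injective (Fin.ext (ha _ _ (by omega) (by omega) hij))
  -- Omitting `k` leaves the exponent sum `(0 + 1 + ⋯ + n) - k`, so different alternants give
  -- different powers of `z`.
  have hinj : ∀ k l : Fin (n + 1), ∑ j, (k.succAbove j : ℕ) = ∑ j, (l.succAbove j : ℕ) → k = l := by
    intro k l hkl
    have h1 := Fin.sum_univ_succAbove (fun i : Fin (n + 1) => (i : ℕ)) k
    have h2 := Fin.sum_univ_succAbove (fun i : Fin (n + 1) => (i : ℕ)) l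
    exact Fin.ext (by omega)
  have hP : ∑ k, Polynomial.C (c k * v k) * Polynomial.X ^ (∑ j, (k.succAbove j : ℕ)) = 0 := by
    refine Polynomial.funext fun z => ?_
    rw [Polynomial.eval_finsetSum, Polynomial.eval_zero, ← h z]
    refine Finset.sum_congr rfl fun k _ => ?_
    simp only [Polynomial.eval_mul, Polynomial.eval_C, Polynomial.eval_pow, Polynomial.eval_X, hv]
    ring
  refine Finset.sum_eq_zero fun k _ => ?_
  have hk := congrArg (fun p => Polynomial.coeff p (∑ j, (k.succAbove j : ℕ))) hP
  simp only [Polynomial.finsetSum_coeff, Polynomial.coeff_C_mul, Polynomial.coeff_X_pow,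
    Polynomial.coeff_zero] at hk
  rw [Finset.sum_eq_single k (fun l _ hl => by rw [if_neg fun e => hl (hinj _ _ e).symm, mul_zero])
    (by simp), if_pos rfl, mul_one] at hk
  rw [(mul_eq_zero.1 hk).resolve_right (hv0 k), zero_mul]

/-! ### Numerators of Matsuo's functions -/

/-- The polynomial whose alternating sum is the numerator of Matsuo's rational functions. -/
noncomputable def matsuoPoly {n : ℕ} (c : ℂ) (u : Fin n → ℂ) : MvPolynomial (Fin n) ℂ :=
  (∏ k, (1 - MvPolynomial.C (u k) * MvPolynomial.X k)) *
    ∏ i : Fin n, ∏ j : Fin n with i < j, (MvPolynomial.X i - MvPolynomial.C c * MvPolynomial.X j)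

theorem eval_matsuoPoly {n : ℕ} (c : ℂ) (u t : Fin n → ℂ) :
    MvPolynomial.eval t (matsuoPoly c u) =
      (∏ k, (1 - u k * t k)) * ∏ i : Fin n, ∏ j : Fin n with i < j, (t i - c * t j) := by
  simp [matsuoPoly]

/-- Each variable occurs in one linear factor of the first product and in `n - 1` of the pair
factors. -/
theorem degreeOf_matsuoPoly_le {n : ℕ} (c : ℂ) (u : Fin n → ℂ) (i : Fin n) :
    (matsuoPoly c u).degreeOf i ≤ n := by
  have hX : ∀ (b : ℂ) (k : Fin n), (MvPolynomial.C b * MvPolynomial.X k).degreeOf i ≤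
      if k = i then 1 else 0 := by
    intro b k
    refine (MvPolynomial.degreeOf_C_mul_le _ _ _).trans ?_
    rw [MvPolynomial.degreeOf_X]
    simp [eq_comm]
  have h1 : (∏ k, (1 - MvPolynomial.C (u k) * MvPolynomial.X k)).degreeOf i ≤ 1 := by
    refine (MvPolynomial.degreeOf_prod_le _ _ _).trans ?_
    refine (Finset.sum_le_sum (g := fun k => if k = i then 1 else 0) fun k _ => ?_).trans (by simp)
    refine (MvPolynomial.degreeOf_sub_le _ _ _).trans (max_le ?_ (hX _ _))
    simp
  have h2 : (∏ l : Fin n, ∏ j : Fin n with l < j,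
      (MvPolynomial.X l - MvPolynomial.C c * MvPolynomial.X j)).degreeOf i ≤ n - 1 := by
    refine (MvPolynomial.degreeOf_prod_le _ _ _).trans ?_
    refine (Finset.sum_le_sum (g := fun l => ∑ j : Fin n with l < j,
      ((if l = i then 1 else 0) + if j = i then 1 else 0)) fun l _ => ?_).trans ?_
    · refine (MvPolynomial.degreeOf_prod_le _ _ _).trans (Finset.sum_le_sum fun j _ => ?_)
      refine (MvPolynomial.degreeOf_sub_le _ _ _).trans (max_le ?_ ?_)
      · have := hX 1 l
        rw [MvPolynomial.C_1, one_mul] at this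
        omega
      · exact (hX _ _).trans (by omega)
    · simp only [Finset.sum_add_distrib, Finset.sum_filter]
      rw [Finset.sum_eq_single i (by intro b _ hb; simp [hb]) (by simp)]
      have : ∀ l : Fin n, (∑ j, if l < j then (if j = i then 1 else 0) else 0) =
          if l < i then 1 else 0 := by
        intro l
        rw [Finset.sum_eq_single i (by intro b _ hb; simp [hb]) (by simp)]
        simp
      simp only [this, if_true, ← Finset.sum_filter, ← Finset.card_eq_sum_ones,
        Finset.filter_lt_eq_Ioi, Finset.filter_gt_eq_Iio, Fin.card_Ioi, Fin.card_Iio]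
      omega
  refine (MvPolynomial.degreeOf_mul_le _ _ _).trans ?_
  have := i.pos
  omega

/-- For `σ ≠ 1` there are neighbouring values `σ i = σ j + 1` in the wrong order `i < j`; the factor
of that pair is zero because consecutive points have ratio `a`. -/
theorem altSum_matsuoPoly_geometric {n : ℕ} {a : ℂ} (ha : a ≠ 0) (z : ℂ) (u : Fin n → ℂ) :
    altSum (fun t => MvPolynomial.eval t (matsuoPoly a⁻¹ u)) (fun i => z * a ^ (i.rev : ℕ)) =
      MvPolynomial.eval (fun i => z * a ^ (i.rev : ℕ)) (matsuoPoly a⁻¹ u) := by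
  rw [altSum, Finset.sum_eq_single 1]
  · simp
  · intro σ _ hσ
    rw [eval_matsuoPoly]
    obtain ⟨i, j, hij, h⟩ : ∃ i j : Fin n, i < j ∧ (σ i : ℕ) = σ j + 1 := by
      by_contra! H
      apply hσ
      obtain _ | n := n
      · exact Subsingleton.elim _ _
      -- Without such a pair `σ⁻¹` increases at every step, and the only increasing permutation is
      -- the identity.
      have hmono : StrictMono (σ⁻¹ : Equiv.Perm (Fin (n + 1))) := by
        refine Fin.strictMono_iff_lt_succ.2 fun i => ?_
        by_contra hlt
        have hne : σ⁻¹ i.succ ≠ σ⁻¹ i.castSucc := fun e => by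
          have := congrArg Fin.val (σ⁻¹.injective e)
          simp at this
        exact H _ _ (lt_of_le_of_ne (not_lt.1 hlt) hne) (by simp)
      have hid := (StrictMono.range_inj hmono strictMono_id).1
        ((σ⁻¹).surjective.range_eq.trans Set.range_id.symm)
      rw [← inv_eq_one]
      ext i
      simp [hid]
    have h0 : z * a ^ ((σ i).rev : ℕ) - a⁻¹ * (z * a ^ ((σ j).rev : ℕ)) = 0 := by
      have : ((σ j).rev : ℕ) = (σ i).rev + 1 := by
        have := (σ i).isLt
        simp only [Fin.val_rev]
        omega
      rw [this, pow_succ]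
      field_simp
      ring
    have : ∏ i : Fin n, ∏ j : Fin n with i < j,
        (z * a ^ ((σ i).rev : ℕ) - a⁻¹ * (z * a ^ ((σ j).rev : ℕ))) = 0 :=
      Finset.prod_eq_zero (Finset.mem_univ i)
        (Finset.prod_eq_zero (Finset.mem_filter.2 ⟨Finset.mem_univ j, hij⟩) h0)
    rw [this, mul_zero, mul_zero]
  · simp

/-! ### Powers of `q` and the entries of the Gauss factors -/

theorem qpow_add (τ z w : ℂ) : qpow τ (z + w) = qpow τ z * qpow τ w := by
  rw [qpow, qpow, qpow, mul_add, Complex.exp_add]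

theorem qpow_ne_zero (τ z : ℂ) : qpow τ z ≠ 0 := Complex.exp_ne_zero _

theorem qpow_neg (τ z : ℂ) : qpow τ (-z) = (qpow τ z)⁻¹ := by
  rw [qpow, qpow, mul_neg, Complex.exp_neg]

theorem qpow_nat_mul (τ z : ℂ) (k : ℕ) : qpow τ (k * z) = qpow τ z ^ k := by
  rw [qpow, qpow, ← Complex.exp_nat_mul]
  congr 1
  ring

theorem qpow_int_mul (τ z : ℂ) (k : ℤ) : qpow τ (k * z) = qpow τ z ^ k := by
  rw [qpow, qpow, ← Complex.exp_int_mul]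
  congr 1
  ring

theorem qpow_zero (τ : ℂ) : qpow τ 0 = 1 := by simp [qpow]

theorem prod_range_qpow (τ γ z : ℂ) (j : ℕ) :
    ∏ i ∈ Finset.range j, qpow τ (z + i * γ) = qpow τ (j * z + j * ((j : ℂ) - 1) / 2 * γ) := by
  induction j with
  | zero => simp [qpow_zero]
  | succ j ih =>
    rw [Finset.prod_range_succ, ih, ← qpow_add]
    congr 1
    push_cast
    ring

/-- Factoring `-q^(z + iγ)` out of each term and reversing the order gives a Pochhammer product.
This accounts for the signs and half-integral exponents in the Gauss factors. -/
theorem prod_range_sub_qpow (τ γ z x : ℂ) (j : ℕ) :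
    ∏ i ∈ Finset.range j, (x - qpow τ (z + i * γ)) =
      (-1) ^ j * qpow τ (j * z + j * ((j : ℂ) - 1) / 2 * γ) *
        qPoch (x * qpow τ (-(z + ((j : ℂ) - 1) * γ))) (qpow τ γ) j := by
  have h : ∀ i ∈ Finset.range j, x - qpow τ (z + i * γ) = -1 * qpow τ (z + i * γ) *
      (1 - qpow τ γ ^ (j - 1 - i) * (x * qpow τ (-(z + ((j : ℂ) - 1) * γ)))) := by
    intro i hi
    have hi := Finset.mem_range.1 hi
    have : qpow τ (z + i * γ) * qpow τ γ ^ (j - 1 - i) * qpow τ (-(z + ((j : ℂ) - 1) * γ)) = 1 := by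
      rw [← qpow_nat_mul, ← qpow_add, ← qpow_add]
      convert qpow_zero τ using 2
      rw [Nat.sub_sub, Nat.cast_sub (by omega)]
      push_cast
      ring
    linear_combination x * (-this)
  rw [Finset.prod_congr rfl h, Finset.prod_mul_distrib, Finset.prod_mul_distrib,
    prod_range_qpow, Finset.prod_const, Finset.card_range, qPoch,
    Finset.prod_range_reflect (fun i => 1 - qpow τ γ ^ i *
      (x * qpow τ (-(z + ((j : ℂ) - 1) * γ)))) j]

theorem qpow_add_nat_mul (τ γ z : ℂ) (k : ℕ) :
    qpow τ (z + k * γ) = qpow τ z * qpow τ γ ^ k := by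
  rw [qpow_add, qpow_nat_mul]

/-- The form matching `sum_saalschutz`: the denominator is the tail of `∏ (x a^s - a^i)` over `i < n
- s`. -/
theorem gaussL'_apply (τ γ x β₂ : ℂ) {n j k : ℕ} (r s : Fin (n + 1)) (hr : (r : ℕ) = s + j)
    (hn : n = r + k) :
    gaussL' τ γ n x β₂ r s = gaussBinom (qpow τ γ) j k *
      qPoch (qpow τ β₂ * qpow τ γ ^ (s : ℕ)) (qpow τ γ) j /
        ∏ i ∈ Finset.range j, (x * qpow τ γ ^ (s : ℕ) - qpow τ γ ^ (k + i)) := by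
  have h := prod_range_sub_qpow τ γ (k * γ) (x * qpow τ γ ^ (s : ℕ)) j
  simp only [← add_mul, ← Nat.cast_add, qpow_nat_mul] at h
  rw [h]
  have e1 : (n - s : ℕ) = j + k := by omega
  have e2 : (r - s : ℕ) = j := by omega
  have e3 : (n - r : ℕ) = k := by omega
  simp only [gaussL', Matrix.of_apply, if_pos (show (s : ℕ) ≤ r by omega), e1, e2, e3]
  rw [qpow_add_nat_mul, gaussBinom]
  have hnc : (n : ℂ) = s + j + k := by exact_mod_cast hn.trans (by rw [hr])
  have hrc : ((r : ℕ) : ℂ) = s + j := by exact_mod_cast hr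
  have a1 : x * qpow τ (-(((n : ℂ) - 2 * s - 1) * γ)) =
      x * qpow τ γ ^ (s : ℕ) * qpow τ (-(k * γ + ((j : ℂ) - 1) * γ)) := by
    rw [mul_assoc, ← qpow_nat_mul, ← qpow_add, hnc]
    congr 2
    ring
  have a2 : qpow τ (-(((r : ℂ) - s) * (2 * (n : ℂ) - r - s - 1) * γ / 2)) =
      (qpow τ (j * (k * γ) + j * ((j : ℂ) - 1) / 2 * γ))⁻¹ := by
    rw [← qpow_neg, hnc, hrc]
    congr 1
    ring
  have a3 : ((-1 : ℂ) ^ j) = ((-1) ^ j)⁻¹ := by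
    rw [← inv_pow, inv_neg, inv_one]
  rw [a1, a2]
  nth_rw 1 [a3]
  simp only [div_eq_mul_inv, mul_inv]
  ring_nf

theorem prod_range_sub_eq_qPoch {a Y : ℂ} (ha : a ≠ 0) (r k : ℕ) :
    ∏ i ∈ Finset.range r, (a ^ k - Y * a ^ i) = a ^ (r * k) * qPoch (Y * (a ^ k)⁻¹) a r := by
  rw [mul_comm r k, pow_mul, qPoch]
  nth_rw 2 [← Finset.card_range r]
  rw [← Finset.prod_const, ← Finset.prod_mul_distrib]
  refine Finset.prod_congr rfl fun i _ => ?_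
  have : a ^ k ≠ 0 := pow_ne_zero _ ha
  field_simp

theorem interpWeight_eq {a Y : ℂ} (ha : a ≠ 0) (hY : Y ≠ 0) (r k : ℕ) :
    interpWeight a Y r k = (a ^ (r * k))⁻¹ * gaussBinom a r k /
      (qPoch (Y * (a ^ k)⁻¹) a r * qPoch (Y⁻¹ * (a ^ r)⁻¹) a k) := by
  have h : ∏ i ∈ Finset.range k, (Y * a ^ r - a ^ i) =
      Y ^ k * (a ^ (k * r) * qPoch (Y⁻¹ * (a ^ r)⁻¹) a k) := by
    rw [← prod_range_sub_eq_qPoch ha]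
    nth_rw 2 [← Finset.card_range k]
    rw [← Finset.prod_const, ← Finset.prod_mul_distrib]
    refine Finset.prod_congr rfl fun i _ => ?_
    field_simp
  rw [interpWeight, h, prod_range_sub_eq_qPoch ha, mul_comm k r]
  have h1 : a ^ (r * k) ≠ 0 := pow_ne_zero _ ha
  have h2 : Y ^ k ≠ 0 := pow_ne_zero _ hY
  simp only [div_eq_mul_inv, mul_inv]
  field_simp

/-- The Pochhammer denominator left over from the diagonal factor joins that of the upper factor to
form an interpolation weight with `Y = x a^(-e)`, where `e = n - s`. -/
theorem gaussU'_apply (τ γ β₁ : ℂ) {x : ℂ} (hx : x ≠ 0) {n k e : ℕ} (r s : Fin (n + 1))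
    (hs : (s : ℕ) = r + k) (hn : n = s + e) :
    qPoch (x * qpow τ β₁) (qpow τ γ) r / qPoch (x * qpow τ (-(((n : ℂ) - r) * γ))) (qpow τ γ) r *
      gaussU' τ γ n x β₁ r s = interpWeight (qpow τ γ) (x * (qpow τ γ ^ e)⁻¹) r k *
      qPoch (x * qpow τ β₁) (qpow τ γ) r * qPoch (qpow τ β₁ * qpow τ γ ^ e) (qpow τ γ) k := by
  have ha := qpow_ne_zero τ γ
  have hnc : (n : ℂ) = r + k + e := by exact_mod_cast hn.trans (by rw [hs])
  have hsc : ((s : ℕ) : ℂ) = r + k := by exact_mod_cast hs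
  rw [interpWeight_eq ha (mul_ne_zero hx (inv_ne_zero (pow_ne_zero _ ha)))]
  have e1 : (s - r : ℕ) = k := by omega
  simp only [gaussU', Matrix.of_apply, if_pos (show (r : ℕ) ≤ s by omega), e1]
  have a1 : x * qpow τ (-(((n : ℂ) - r) * γ)) =
      x * (qpow τ γ ^ e)⁻¹ * (qpow τ γ ^ k)⁻¹ := by
    rw [mul_assoc, ← qpow_nat_mul, ← qpow_nat_mul, ← qpow_neg, ← qpow_neg, ← qpow_add, hnc]
    congr 2
    ring
  have a2 : x⁻¹ * qpow τ (((n : ℂ) - r - s) * γ) =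
      (x * (qpow τ γ ^ e)⁻¹)⁻¹ * (qpow τ γ ^ (r : ℕ))⁻¹ := by
    rw [mul_inv, inv_inv, mul_assoc, ← qpow_nat_mul, ← qpow_nat_mul, ← qpow_neg, ← qpow_add,
      hnc, hsc]
    congr 2
    ring
  have a3 : qpow τ (-(((s : ℂ) - r) * r * γ)) = (qpow τ γ ^ ((r : ℕ) * k))⁻¹ := by
    rw [← qpow_nat_mul, ← qpow_neg, hsc]
    push_cast
    congr 1
    ring
  have a4 : qpow τ (β₁ + ((n : ℂ) - s) * γ) = qpow τ β₁ * qpow τ γ ^ e := by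
    rw [← qpow_add_nat_mul, hnc, hsc]
    congr 1
    ring
  rw [a1, a2, a3, a4, gaussBinom, hs, mul_comm (qPoch (qpow τ γ) (qpow τ γ) k)]
  simp only [div_eq_mul_inv, mul_inv]
  ring

/-- The quotient of products in front is the scalar produced by the lower factor; the diagonal entry
cancels it and leaves the part used by the upper factor. -/
theorem gaussD'_apply (τ γ β₁ β₂ : ℂ) {x : ℂ} {n m : ℕ} (r : Fin (n + 1)) (hn : n = r + m)
    (h1 : ∏ i ∈ Finset.range m, (x * qpow τ γ ^ (r : ℕ) - qpow τ γ ^ i) ≠ 0)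
    (h2 : ∏ i ∈ Finset.range m,
      (x * qpow τ γ ^ (r : ℕ) - qpow τ β₂ * qpow τ γ ^ (r : ℕ) * qpow τ γ ^ i) ≠ 0) :
    (∏ i ∈ Finset.range m,
      (x * qpow τ γ ^ (r : ℕ) - qpow τ β₂ * qpow τ γ ^ (r : ℕ) * qpow τ γ ^ i)) /
      (∏ i ∈ Finset.range m, (x * qpow τ γ ^ (r : ℕ) - qpow τ γ ^ i)) *
        gaussD' τ γ n x β₁ β₂ r r =
    qPoch (x * qpow τ β₁) (qpow τ γ) r /
      qPoch (x * qpow τ (-(((n : ℂ) - r) * γ))) (qpow τ γ) r := by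
  have hnc : (n : ℂ) = r + m := by exact_mod_cast hn
  have e1 := prod_range_sub_qpow τ γ 0 (x * qpow τ γ ^ (r : ℕ)) m
  have e2 := prod_range_sub_qpow τ γ (β₂ + (r : ℕ) * γ) (x * qpow τ γ ^ (r : ℕ)) m
  simp only [zero_add, qpow_nat_mul, qpow_add_nat_mul] at e1 e2
  have a1 : x * qpow τ γ ^ (r : ℕ) * qpow τ (-(((m : ℂ) - 1) * γ)) =
      x * qpow τ (-(((n : ℂ) - 2 * r - 1) * γ)) := by
    rw [mul_assoc, ← qpow_nat_mul, ← qpow_add, hnc]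
    congr 2
    ring
  have a2 : x * qpow τ γ ^ (r : ℕ) * qpow τ (-(β₂ + (r : ℕ) * γ + ((m : ℂ) - 1) * γ)) =
      x * qpow τ (-β₂ - ((n : ℂ) - r - 1) * γ) := by
    rw [mul_assoc, ← qpow_nat_mul, ← qpow_add, hnc]
    congr 2
    ring
  have a3 : qpow τ (m * (β₂ + (r : ℕ) * γ) + m * ((m : ℂ) - 1) / 2 * γ) =
      (qpow τ (-(((n : ℂ) - r) * (β₂ + r * γ))))⁻¹ *
        qpow τ (m * 0 + m * ((m : ℂ) - 1) / 2 * γ) := by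
    rw [← qpow_neg, ← qpow_add, hnc]
    congr 1
    ring
  rw [a1] at e1
  rw [a2, a3] at e2
  rw [e1] at h1 ⊢
  rw [e2] at h2 ⊢
  have e3 : (n - r : ℕ) = m := by omega
  simp only [gaussD', Matrix.diagonal_apply_eq, e3]
  have q1 := right_ne_zero_of_mul h1
  have q2 := right_ne_zero_of_mul h2
  have q3 := qpow_ne_zero τ (-(((n : ℂ) - r) * (β₂ + r * γ)))
  have q4 := left_ne_zero_of_mul h1
  generalize qpow τ (-(((n : ℂ) - r) * (β₂ + r * γ))) = Q at *
  generalize qPoch (x * qpow τ (-(((n : ℂ) - 2 * r - 1) * γ))) (qpow τ γ) m = A at *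
  generalize qPoch (x * qpow τ (-β₂ - ((n : ℂ) - r - 1) * γ)) (qpow τ γ) m = B at *
  simp only [mul_zero, zero_add] at *
  rw [show (-1) ^ m * (Q⁻¹ * qpow τ (m * ((m : ℂ) - 1) / 2 * γ)) * B /
    ((-1) ^ m * qpow τ (m * ((m : ℂ) - 1) / 2 * γ) * A) = Q⁻¹ * B / A by
      have h := div_self q4
      generalize (-1 : ℂ) ^ m = E at *
      generalize qpow τ (m * ((m : ℂ) - 1) / 2 * γ) = F at *
      rw [show E * (Q⁻¹ * F) * B / (E * F * A) = (E * F / (E * F)) * (Q⁻¹ * B / A) by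
        simp only [div_eq_mul_inv, mul_inv]; ring, h, one_mul]]
  simp only [div_eq_mul_inv]
  field_simp

/-! ### The Gauss decomposition in one variable -/

theorem sum_fin_eq_antidiagonal_of_ge {n : ℕ} (r : Fin (n + 1)) (F : Fin (n + 1) → ℂ)
    (f : ℕ → ℕ → ℂ) (h0 : ∀ i, i < r → F i = 0)
    (h : ∀ (i : Fin (n + 1)) (j k : ℕ), (i : ℕ) = r + j → n = i + k → F i = f j k) :
    ∑ i, F i = ∑ p ∈ Finset.HasAntidiagonal.antidiagonal (n - r), f p.1 p.2 := by
  have hF : ∀ i, F i = (fun i : ℕ => if (r : ℕ) ≤ i then f (i - r) (n - i) else 0) i := by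
    intro i
    by_cases hi : (r : ℕ) ≤ i
    · simp only [if_pos hi]
      exact h i _ _ (by omega) (by omega)
    · simp only [if_neg hi]
      exact h0 i (by simpa using hi)
  simp only [hF]
  rw [Fin.sum_univ_eq_sum_range (fun i : ℕ => if (r : ℕ) ≤ i then f (i - r) (n - i) else 0),
    show Finset.range (n + 1) = Finset.range (r + (n - r + 1)) from congrArg _ (by omega), Finset.sum_range_add, Finset.sum_eq_zero, zero_add,
    Finset.Nat.sum_antidiagonal_eq_sum_range_succ_mk]
  · refine Finset.sum_congr rfl fun i _ => ?_
    rw [if_pos (by omega)]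
    congr 1 <;> omega
  · intro i hi
    rw [if_neg (by simpa using hi)]

theorem sum_fin_eq_antidiagonal_of_le {n : ℕ} (s : Fin (n + 1)) (F : Fin (n + 1) → ℂ)
    (f : ℕ → ℕ → ℂ) (h0 : ∀ i, s < i → F i = 0)
    (h : ∀ (i : Fin (n + 1)) (k : ℕ), (s : ℕ) = i + k → F i = f i k) :
    ∑ i, F i = ∑ p ∈ Finset.HasAntidiagonal.antidiagonal (s : ℕ), f p.1 p.2 := by
  have hF : ∀ i, F i = (fun i : ℕ => if i ≤ (s : ℕ) then f i (s - i) else 0) i := by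
    intro i
    by_cases hi : (i : ℕ) ≤ s
    · simp only [if_pos hi]
      exact h i _ (by omega)
    · simp only [if_neg hi]
      exact h0 i (by simpa using hi)
  simp only [hF]
  rw [Fin.sum_univ_eq_sum_range (fun i : ℕ => if i ≤ (s : ℕ) then f i (s - i) else 0),
    show Finset.range (n + 1) = Finset.range (s + 1 + (n - s)) from congrArg _ (by omega), Finset.sum_range_add, add_comm,
    Finset.sum_eq_zero, zero_add, Finset.Nat.sum_antidiagonal_eq_sum_range_succ_mk]
  · refine Finset.sum_congr rfl fun i hi => ?_
    rw [if_pos (by simpa [Nat.lt_succ_iff] using hi)]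
  · intro i hi
    rw [if_neg (by omega)]

/-- This is `sum_saalschutz` with `B = q^β₂ a^r`, `X = x a^r`, `y = w/x`, multiplied by `(w;a)_r`;
since `X y = a^r w`, the factors `(w;a)_r (X y;a)_j` combine to `(w;a)_(r+j)`. -/
theorem sum_qPoch_mul_gaussL' (τ γ β₂ w : ℂ) {x : ℂ} (hx : x ≠ 0) {n : ℕ}
    (ha : ∀ i ≤ n, qPoch (qpow τ γ) (qpow τ γ) i ≠ 0) (r : Fin (n + 1))
    (h1 : ∏ i ∈ Finset.range (n - r), (x * qpow τ γ ^ (r : ℕ) - qpow τ γ ^ i) ≠ 0) :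
    ∑ i : Fin (n + 1), qPoch w (qpow τ γ) i *
        qPoch (qpow τ γ ^ (i : ℕ) * (qpow τ β₂ * w / x)) (qpow τ γ) (n - i) *
        gaussL' τ γ n x β₂ i r =
      (∏ i ∈ Finset.range (n - r),
        (x * qpow τ γ ^ (r : ℕ) - qpow τ β₂ * qpow τ γ ^ (r : ℕ) * qpow τ γ ^ i)) /
      (∏ i ∈ Finset.range (n - r), (x * qpow τ γ ^ (r : ℕ) - qpow τ γ ^ i)) *
      (qPoch w (qpow τ γ) r * qPoch (w / x) (qpow τ γ) (n - r)) := by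
  set a := qpow τ γ with ha'
  set b := qpow τ β₂
  rw [div_mul_eq_mul_div, mul_left_comm, ← sum_saalschutz a (b * a ^ (r : ℕ)) (x * a ^ (r : ℕ))
    (w / x) _ (fun i hi => ha i (by omega)), Finset.mul_sum, Finset.sum_div]
  refine sum_fin_eq_antidiagonal_of_ge r _ (fun j k => qPoch w a r *
    (gaussBinom a j k * qPoch (b * a ^ (r : ℕ)) a j *
        qPoch (b * a ^ (r : ℕ) * a ^ j * (w / x)) a k * qPoch (x * a ^ (r : ℕ) * (w / x)) a j *
        ∏ i ∈ Finset.range k, (x * a ^ (r : ℕ) - a ^ i)) /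
      (∏ i ∈ Finset.range (n - r), (x * a ^ (r : ℕ) - a ^ i))) ?_ ?_
  · intro i hi
    simp [gaussL', hi]
  · intro i j k hi hn
    rw [gaussL'_apply τ γ x β₂ i r hi hn, ← ha']
    have e1 : n - (r : ℕ) = k + j := by omega
    have e2 : n - (i : ℕ) = k := by omega
    -- The first `k` factors cancel the product in the Saalschütz term; the other `j` are the
    -- denominator of the matrix entry.
    rw [e1, Finset.prod_range_add] at h1 ⊢
    have q1 := left_ne_zero_of_mul h1
    rw [e2, hi, qPoch_add, show x * a ^ (r : ℕ) * (w / x) = a ^ (r : ℕ) * w by field_simp,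
      show a ^ ((r : ℕ) + j) * (b * w / x) = b * a ^ (r : ℕ) * a ^ j * (w / x) by ring]
    rw [mul_comm (∏ i ∈ Finset.range k, (x * a ^ (r : ℕ) - a ^ i)), ← mul_assoc,
      mul_div_mul_right _ _ q1]
    ring

/-- The one-variable form of the Gauss decomposition. -/
theorem sum_qPoch_mul_gauss (τ γ β₁ β₂ w : ℂ) {x : ℂ} (hx0 : x ≠ 0) {n : ℕ}
    (ha : ∀ i ≤ n, qPoch (qpow τ γ) (qpow τ γ) i ≠ 0)
    (hx : ∀ i j, i < n → j < n → x * qpow τ γ ^ i ≠ qpow τ γ ^ j)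
    (hβ : ∀ i < n, x ≠ qpow τ β₂ * qpow τ γ ^ i) (s : Fin (n + 1)) :
    ∑ i : Fin (n + 1), qPoch w (qpow τ γ) i *
        qPoch (qpow τ γ ^ (i : ℕ) * (qpow τ β₂ * w / x)) (qpow τ γ) (n - i) *
        (gaussL' τ γ n x β₂ * gaussD' τ γ n x β₁ β₂ * gaussU' τ γ n x β₁) i s =
      qPoch (w / x) (qpow τ γ) (n - s) *
        qPoch (qpow τ γ ^ (n - s : ℕ) * (qpow τ β₁ * w)) (qpow τ γ) s := by
  have ha0 := qpow_ne_zero τ γ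
  have hr0 : ∀ r : ℕ, qpow τ γ ^ r ≠ 0 := fun r => pow_ne_zero _ ha0
  have h1 : ∀ r : Fin (n + 1),
      ∏ i ∈ Finset.range (n - r), (x * qpow τ γ ^ (r : ℕ) - qpow τ γ ^ i) ≠ 0 := fun r =>
    Finset.prod_ne_zero_iff.2 fun i hi => by
      have := Finset.mem_range.1 hi
      exact sub_ne_zero.2 (hx r i (by omega) (by omega))
  have h2 : ∀ r : Fin (n + 1), ∏ i ∈ Finset.range (n - r),
      (x * qpow τ γ ^ (r : ℕ) - qpow τ β₂ * qpow τ γ ^ (r : ℕ) * qpow τ γ ^ i) ≠ 0 := fun r =>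
    Finset.prod_ne_zero_iff.2 fun i hi => by
      have := Finset.mem_range.1 hi
      rw [mul_right_comm, ← sub_mul]
      exact mul_ne_zero (sub_ne_zero.2 (hβ i (by omega))) (hr0 _)
  have hD : ∀ i l : Fin (n + 1), (gaussL' τ γ n x β₂ * gaussD' τ γ n x β₁ β₂) i l =
      gaussL' τ γ n x β₂ i l * gaussD' τ γ n x β₁ β₂ l l := by
    intro i l
    rw [gaussD', Matrix.mul_diagonal, Matrix.diagonal_apply_eq]
  simp only [Matrix.mul_apply (N := gaussU' τ γ n x β₁), hD, Finset.mul_sum]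
  rw [Finset.sum_comm]
  have hl : ∀ l : Fin (n + 1), ∑ i : Fin (n + 1), qPoch w (qpow τ γ) i *
        qPoch (qpow τ γ ^ (i : ℕ) * (qpow τ β₂ * w / x)) (qpow τ γ) (n - i) *
        (gaussL' τ γ n x β₂ i l * gaussD' τ γ n x β₁ β₂ l l * gaussU' τ γ n x β₁ l s) =
      qPoch w (qpow τ γ) l * qPoch (w / x) (qpow τ γ) (n - l) *
      (qPoch (x * qpow τ β₁) (qpow τ γ) l /
        qPoch (x * qpow τ (-(((n : ℂ) - l) * γ))) (qpow τ γ) l * gaussU' τ γ n x β₁ l s) := by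
    intro l
    rw [← gaussD'_apply τ γ β₁ β₂ l (show n = l + (n - l) by omega) (h1 l) (h2 l)]
    have := sum_qPoch_mul_gaussL' τ γ β₂ w hx0 ha l (h1 l)
    simp only [← mul_assoc, ← Finset.sum_mul]
    simp only [← mul_assoc] at this
    rw [this]
    ring
  simp only [hl]
  -- With `Y = x a^(-(n-s))` and `b = q^β₁ a^(n-s)`, one has `Y b = x q^β₁` and `w/Y = a^(n-s) w/x`,
  -- so `(w/Y;a)_k` continues `(w/x;a)_(n-s)`.
  have key := sum_interpolation ha0 (mul_ne_zero hx0 (inv_ne_zero (hr0 (n - s))))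
    (qpow τ β₁ * qpow τ γ ^ (n - s : ℕ)) w s (fun i hi => ha i (by omega))
    (fun i j hi hj => by
      have := hx i (j + (n - s)) (by omega) (by omega)
      rw [pow_add] at this
      intro h
      apply this
      rw [← h]
      have := hr0 (n - s)
      field_simp)
  rw [show qpow τ γ ^ (n - s : ℕ) * (qpow τ β₁ * w) =
    qpow τ β₁ * qpow τ γ ^ (n - s : ℕ) * w by ring, ← key, Finset.mul_sum]
  refine sum_fin_eq_antidiagonal_of_le s _ (fun r k => qPoch (w / x) (qpow τ γ) (n - s) *
    (interpWeight (qpow τ γ) (x * (qpow τ γ ^ (n - s : ℕ))⁻¹) r k * qPoch w (qpow τ γ) r *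
      qPoch (x * (qpow τ γ ^ (n - s : ℕ))⁻¹ * (qpow τ β₁ * qpow τ γ ^ (n - s : ℕ))) (qpow τ γ) r *
      qPoch (qpow τ β₁ * qpow τ γ ^ (n - s : ℕ)) (qpow τ γ) k *
      qPoch (w / (x * (qpow τ γ ^ (n - s : ℕ))⁻¹)) (qpow τ γ) k)) ?_ ?_
  · intro i hi
    have : ¬ i ≤ s := not_le.2 hi
    simp [gaussU', this]
  · intro i k hik
    rw [gaussU'_apply τ γ β₁ hx0 i s hik (show n = s + (n - s) by omega)]
    have hns := hr0 (n - s)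
    rw [show x * (qpow τ γ ^ (n - s : ℕ))⁻¹ * (qpow τ β₁ * qpow τ γ ^ (n - s : ℕ)) =
      x * qpow τ β₁ by field_simp,
      show w / (x * (qpow τ γ ^ (n - s : ℕ))⁻¹) = qpow τ γ ^ (n - s : ℕ) * (w / x) by field_simp,
      show n - (i : ℕ) = n - s + k by omega, qPoch_add]
    ring

/-! ### Reduction of the matrix relation to one variable -/

/-- The prefactor is symmetric in `t`, so it leaves the alternating sum. Over this denominator, an
index without the quotient contributes the numerator `1 - t_k/y`. -/
theorem matsuo_eq (τ γ β : ℂ) {n s : ℕ} {x y : ℂ} (hx : x ≠ 0) (hy : y ≠ 0) {t : Fin n → ℂ}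
    (ht : ∀ k, t k ≠ y ∧ t k ≠ x) :
    matsuo τ γ n x y β s t = (∏ k, 1 / ((1 - t k / x) * (1 - t k / y))) *
      altSum (fun t => MvPolynomial.eval t (matsuoPoly (qpow τ γ)⁻¹
        fun k : Fin n => if (k : ℕ) < n - s then qpow τ β / x else 1 / y)) t := by
  rw [matsuo, altSum, altSum, Finset.mul_sum]
  refine Finset.sum_congr rfl fun σ _ => ?_
  rw [eval_matsuoPoly, qpow_neg, ← Equiv.prod_comp σ fun k => 1 / ((1 - t k / x) * (1 - t k / y)),
    mul_left_comm (∏ k : Fin n, 1 / ((1 - t (σ k) / x) * (1 - t (σ k) / y))),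
    ← mul_assoc (∏ k : Fin n, 1 / ((1 - t (σ k) / x) * (1 - t (σ k) / y))),
    ← Finset.prod_mul_distrib, Finset.prod_filter, ← Finset.prod_mul_distrib]
  congr 2
  refine Finset.prod_congr rfl fun k _ => ?_
  have h1 : 1 - t (σ k) / x ≠ 0 := by
    rw [sub_ne_zero, ne_comm, ne_eq, div_eq_one_iff_eq hx]
    exact (ht _).2
  have h2 : 1 - t (σ k) / y ≠ 0 := by
    rw [sub_ne_zero, ne_comm, ne_eq, div_eq_one_iff_eq hy]
    exact (ht _).1
  split_ifs
  · rw [one_div, one_div, mul_inv, div_eq_mul_inv]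
    ring
  · rw [show 1 - 1 / y * t (σ k) = 1 - t (σ k) / y by ring, one_div, one_div, mul_inv, mul_assoc,
      inv_mul_cancel₀ h2]

theorem prod_geometric_eq_qPoch (a b x y z : ℂ) {n s : ℕ} (hs : s ≤ n) :
    ∏ k : Fin n, (1 - (if (k : ℕ) < n - s then b / x else 1 / y) * (z * a ^ (k.rev : ℕ))) =
      qPoch (z / y) a s * qPoch (a ^ s * (b * z / x)) a (n - s) := by
  rw [← Equiv.prod_comp Fin.revPerm]
  simp only [Fin.revPerm_apply, Fin.rev_rev, Fin.val_rev]
  rw [Finset.prod_congr rfl (g := fun k : Fin n =>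
    (fun k : ℕ => if k < s then 1 - a ^ k * (z / y) else 1 - a ^ k * (b * z / x)) k)]
  · rw [Fin.prod_univ_eq_prod_range
      (fun k : ℕ => if k < s then 1 - a ^ k * (z / y) else 1 - a ^ k * (b * z / x)),
      ← Nat.add_sub_cancel' hs, Finset.prod_range_add, Nat.add_sub_cancel' hs]
    congr 1
    · exact Finset.prod_congr rfl fun k hk => if_pos (Finset.mem_range.1 hk)
    · refine Finset.prod_congr rfl fun k _ => ?_
      rw [if_neg (by omega)]
      ring
  · intro k _
    by_cases hk : (k : ℕ) < s
    · simp only [hk, if_true]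
      rw [if_neg (by omega)]
      ring
    · simp only [hk, if_false]
      rw [if_pos (by omega)]
      ring

/-- The common factor of the numerators on a geometric progression does not vanish. -/
theorem prod_sub_geometric_ne_zero {n : ℕ} {a z : ℂ} (ha0 : a ≠ 0)
    (ha : ∀ i j : ℕ, i ≤ n → j ≤ n → a ^ i = a ^ j → i = j) (hz : z ≠ 0) :
    ∏ i : Fin n, ∏ j : Fin n with i < j,
      (z * a ^ (i.rev : ℕ) - a⁻¹ * (z * a ^ (j.rev : ℕ))) ≠ 0 := by
  refine Finset.prod_ne_zero_iff.2 fun i _ => Finset.prod_ne_zero_iff.2 fun j hj => ?_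
  have hij : (i : ℕ) < j := (Finset.mem_filter.1 hj).2
  intro h
  have hpow : a ^ ((i.rev : ℕ) + 1) = a ^ (j.rev : ℕ) := by
    apply mul_left_cancel₀ hz
    have := sub_eq_zero.1 h
    rw [pow_succ, ← mul_assoc, this]
    field_simp
  have := ha _ _ (by omega) (by omega) hpow
  simp only [Fin.val_rev] at this
  omega

/-- Linear independence of the univariate polynomials attached to the functions `φ_s`. -/
theorem eq_zero_of_sum_qPoch_eq_zero {n : ℕ} {a u : ℂ} (ha0 : a ≠ 0)
    (ha : ∀ i j : ℕ, i ≤ n → j ≤ n → a ^ i = a ^ j → i = j)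
    (hu : ∀ i < n, a ^ i * u ≠ 1) (c : Fin (n + 1) → ℂ)
    (h : ∀ w : ℂ, ∑ r : Fin (n + 1), qPoch w a r * qPoch (a ^ (r : ℕ) * (u * w)) a (n - r) * c r = 0)
    (r : Fin (n + 1)) : c r = 0 := by
  obtain ⟨r, hr⟩ := r
  induction r using Nat.strong_induction_on with
  | _ r ih =>
    have har : a ^ r ≠ 0 := pow_ne_zero _ ha0
    -- At `w = a^(-r)` the terms with index above `r` vanish through `(w;a)_i`, and those below `r`
    -- vanish by induction.
    have := h (a ^ r)⁻¹
    rw [Finset.sum_eq_single ⟨r, hr⟩ _ (by simp)] at this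
    · refine (mul_eq_zero.1 this).resolve_left (mul_ne_zero ?_ ?_)
      · refine qPoch_ne_zero fun i hi hi1 => ?_
        have hi : i < r := hi
        rw [mul_inv_eq_one₀ har] at hi1
        have := ha i r (by omega) (by omega) hi1
        omega
      · refine qPoch_ne_zero fun i hi => ?_
        have hi : i < n - r := hi
        rw [show a ^ r * (u * (a ^ r)⁻¹) = u by field_simp]
        exact hu i (by omega)
    · intro i _ hir
      obtain ⟨i, hi⟩ := i
      rcases lt_or_gt_of_ne (fun e : i = r => hir (Fin.ext e)) with hlt | hgt
      · rw [ih i hlt hi, mul_zero]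
      · have : qPoch (a ^ r)⁻¹ a i = 0 :=
          Finset.prod_eq_zero (Finset.mem_range.2 hgt) (by rw [mul_inv_cancel₀ har, sub_self])
        simp only [this, zero_mul]

theorem altSum_eval_sum_sub {n : ℕ} {ι : Type*} [Fintype ι] (c : ι → ℂ)
    (G : ι → MvPolynomial (Fin n) ℂ) (H : MvPolynomial (Fin n) ℂ) (t : Fin n → ℂ) :
    altSum (fun t => MvPolynomial.eval t (∑ r, MvPolynomial.C (c r) * G r - H)) t =
      ∑ r, altSum (fun t => MvPolynomial.eval t (G r)) t * c r -
        altSum (fun t => MvPolynomial.eval t H) t := by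
  simp only [altSum, map_sub, map_sum, map_mul, MvPolynomial.eval_C, mul_sub,
    Finset.sum_sub_distrib, Finset.sum_mul, Finset.mul_sum]
  rw [Finset.sum_comm]
  congr 1
  exact Finset.sum_congr rfl fun r _ => Finset.sum_congr rfl fun σ _ => by ring

theorem degreeOf_sum_sub_le {n d : ℕ} {ι : Type*} [Fintype ι] (c : ι → ℂ)
    {G : ι → MvPolynomial (Fin n) ℂ} {H : MvPolynomial (Fin n) ℂ} (i : Fin n)
    (hG : ∀ r, (G r).degreeOf i ≤ d) (hH : H.degreeOf i ≤ d) :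
    (∑ r, MvPolynomial.C (c r) * G r - H).degreeOf i ≤ d := by
  refine (MvPolynomial.degreeOf_sub_le _ _ _).trans (max_le ?_ hH)
  refine (MvPolynomial.degreeOf_sum_le _ _ _).trans (Finset.sup_le fun r _ => ?_)
  exact (MvPolynomial.degreeOf_C_mul_le _ _ _).trans (hG r)

theorem dense_setOf_geometric_ne {n : ℕ} {a : ℂ} (ha0 : a ≠ 0) (x₁ x₂ : ℂ) :
    Dense {z : ℂ | z ≠ 0 ∧ ∀ i : Fin n, z * a ^ (i.rev : ℕ) ≠ x₁ ∧ z * a ^ (i.rev : ℕ) ≠ x₂} := by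
  have hfin : ({0} ∪ Set.range (fun i : Fin n => x₁ / a ^ (i.rev : ℕ)) ∪
      Set.range (fun i : Fin n => x₂ / a ^ (i.rev : ℕ)) : Set ℂ).Finite :=
    ((Set.finite_singleton 0).union (Set.finite_range _)).union (Set.finite_range _)
  refine (hfin.countable.dense_compl ℝ).mono fun z hz => ?_
  simp only [Set.mem_compl_iff, Set.mem_union, Set.mem_singleton_iff, Set.mem_range, not_or,
    not_exists] at hz
  refine ⟨hz.1.1, fun i => ⟨fun h => hz.1.2 i ?_, fun h => hz.2 i ?_⟩⟩ <;>
  · rw [← h, mul_div_cancel_right₀ _ (pow_ne_zero _ ha0)]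

theorem continuous_qPoch {f : ℂ → ℂ} (hf : Continuous f) (c : ℂ) (m : ℕ) :
    Continuous fun z => qPoch (f z) c m := by
  unfold qPoch
  fun_prop

theorem altSum_matsuoPoly_geometric_eq {n s : ℕ} (hs : s ≤ n) {a : ℂ} (ha : a ≠ 0)
    (b x y z : ℂ) :
    altSum (fun t => MvPolynomial.eval t (matsuoPoly a⁻¹
        fun k : Fin n => if (k : ℕ) < n - s then b / x else 1 / y))
        (fun i => z * a ^ (i.rev : ℕ)) =
      qPoch (z / y) a s * qPoch (a ^ s * (b * z / x)) a (n - s) *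
        ∏ i : Fin n, ∏ j : Fin n with i < j,
          (z * a ^ (i.rev : ℕ) - a⁻¹ * (z * a ^ (j.rev : ℕ))) := by
  rw [altSum_matsuoPoly_geometric ha, eval_matsuoPoly, prod_geometric_eq_qPoch _ _ _ _ _ hs]

/-- The defining property of the `R`-matrix reduces to an identity between polynomials in one
variable. -/
theorem isRMatrix21_iff (τ γ : ℂ) {n : ℕ} {x₁ x₂ : ℂ} (β₁ β₂ : ℂ) (hx₁ : x₁ ≠ 0) (hx₂ : x₂ ≠ 0)
    (ha : ∀ i j : ℕ, i ≤ n → j ≤ n → qpow τ γ ^ i = qpow τ γ ^ j → i = j)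
    (R : Matrix (Fin (n + 1)) (Fin (n + 1)) ℂ) :
    IsRMatrix21 τ γ n x₁ x₂ β₁ β₂ R ↔ ∀ (s : Fin (n + 1)) (z : ℂ),
      ∑ r : Fin (n + 1), qPoch (z / x₁) (qpow τ γ) r *
        qPoch (qpow τ γ ^ (r : ℕ) * (qpow τ β₂ * z / x₂)) (qpow τ γ) (n - r) * R r s =
      qPoch (z / x₂) (qpow τ γ) (n - s) *
        qPoch (qpow τ γ ^ (n - s : ℕ) * (qpow τ β₁ * z / x₁)) (qpow τ γ) s := by
  have ha0 := qpow_ne_zero τ γ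
  set a := qpow τ γ
  set G : Fin (n + 1) → MvPolynomial (Fin n) ℂ := fun r => matsuoPoly a⁻¹
    fun k : Fin n => if (k : ℕ) < n - r then qpow τ β₂ / x₂ else 1 / x₁ with hG
  set H : Fin (n + 1) → MvPolynomial (Fin n) ℂ := fun s => matsuoPoly a⁻¹
    fun k : Fin n => if (k : ℕ) < n - (n - s) then qpow τ β₁ / x₁ else 1 / x₂ with hH
  have hgeo : ∀ (s : Fin (n + 1)) (z : ℂ), altSum (fun t => MvPolynomial.eval t
      (∑ r, MvPolynomial.C (R r s) * G r - H s)) (fun i => z * a ^ (i.rev : ℕ)) =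
      (∑ r : Fin (n + 1), qPoch (z / x₁) a r *
        qPoch (a ^ (r : ℕ) * (qpow τ β₂ * z / x₂)) a (n - r) * R r s -
      qPoch (z / x₂) a (n - s) *
        qPoch (a ^ (n - s : ℕ) * (qpow τ β₁ * z / x₁)) a s) *
        ∏ i : Fin n, ∏ j : Fin n with i < j,
          (z * a ^ (i.rev : ℕ) - a⁻¹ * (z * a ^ (j.rev : ℕ))) := by
    intro s z
    rw [altSum_eval_sum_sub, sub_mul, Finset.sum_mul]
    simp only [hG, hH]
    rw [altSum_matsuoPoly_geometric_eq (Nat.sub_le _ _) ha0,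
      Nat.sub_sub_self (Nat.lt_succ_iff.1 s.isLt)]
    congr 1
    refine Finset.sum_congr rfl fun r _ => ?_
    rw [altSum_matsuoPoly_geometric_eq (Nat.lt_succ_iff.1 r.isLt) ha0]
    ring
  have hR : ∀ t : Fin n → ℂ, (∀ k, t k ≠ x₁ ∧ t k ≠ x₂) →
      (Matrix.vecMul (fun s : Fin (n + 1) => matsuo τ γ n x₂ x₁ β₂ s.val t) R =
        (fun s : Fin (n + 1) => matsuo τ γ n x₁ x₂ β₁ (n - s.val) t) ↔
      ∀ s, altSum (fun t => MvPolynomial.eval t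
        (∑ r, MvPolynomial.C (R r s) * G r - H s)) t = 0) := by
    intro t ht
    have hW : (∏ k, 1 / ((1 - t k / x₂) * (1 - t k / x₁))) ≠ 0 := by
      refine Finset.prod_ne_zero_iff.2 fun k _ => one_div_ne_zero (mul_ne_zero ?_ ?_)
      · rw [sub_ne_zero, ne_comm, ne_eq, div_eq_one_iff_eq hx₂]
        exact (ht k).2
      · rw [sub_ne_zero, ne_comm, ne_eq, div_eq_one_iff_eq hx₁]
        exact (ht k).1
    rw [funext_iff]
    refine forall_congr' fun s => ?_
    have hswap : (∏ k, 1 / ((1 - t k / x₁) * (1 - t k / x₂))) =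
        ∏ k, 1 / ((1 - t k / x₂) * (1 - t k / x₁)) :=
      Finset.prod_congr rfl fun k _ => by rw [mul_comm]
    simp only [Matrix.vecMul, dotProduct]
    rw [matsuo_eq τ γ β₁ hx₁ hx₂ fun k => (ht k).symm, hswap, altSum_eval_sum_sub, sub_eq_zero]
    simp only [matsuo_eq τ γ β₂ hx₂ hx₁ ht, mul_assoc, ← Finset.mul_sum]
    exact mul_right_inj' hW
  constructor
  · intro h s
    -- The relation is available only where the progression avoids `x₁` and `x₂`, and the common
    -- factor is nonzero only for `z ≠ 0`. Such `z` are dense, and both sides are continuous.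
    refine congrFun (Continuous.ext_on (dense_setOf_geometric_ne (n := n) ha0 x₁ x₂) ?_ ?_ ?_)
    · refine continuous_finsetSum _ fun r _ => ((continuous_qPoch ?_ _ _).mul
        (continuous_qPoch ?_ _ _)).mul continuous_const <;> fun_prop
    · refine (continuous_qPoch ?_ _ _).mul (continuous_qPoch ?_ _ _) <;> fun_prop
    · intro z hz
      have := (hR _ hz.2).1 (h _ hz.2) s
      rw [hgeo] at this
      exact sub_eq_zero.1
        ((mul_eq_zero.1 this).resolve_right (prod_sub_geometric_ne_zero ha0 ha hz.1))
  · intro h t ht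
    refine (hR t ht).2 fun s => altSum_eq_zero_of_geometric ha _ (fun i => ?_) (fun z => ?_) t
    · exact degreeOf_sum_sub_le _ i (fun r => degreeOf_matsuoPoly_le _ _ i)
        (degreeOf_matsuoPoly_le _ _ i)
    · rw [hgeo, h, sub_self, zero_mul]

/-! ### The Gauss decomposition and uniqueness of the matrix -/

theorem theorem1p3p4 (n : ℕ) (τ : ℂ) (hτ : 0 < τ.im) (γ β₁ β₂ x₁ x₂ : ℂ)
    (hx₁ : x₁ ≠ 0) (hx₂ : x₂ ≠ 0)
    (hγ : ∀ k : ℕ, 1 ≤ k → k ≤ n → qpow τ (k * γ) ≠ 1)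
    (hx : ∀ k : ℤ, |k| < n → x₂ / x₁ ≠ qpow τ (k * γ))
    (hβ : ∀ k : ℕ, k < n → x₂ / x₁ ≠ qpow τ (β₂ + k * γ)) :
    (∀ r, gaussL' τ γ n (x₂ / x₁) β₂ r r = 1) ∧
    (∀ r s, r < s → gaussL' τ γ n (x₂ / x₁) β₂ r s = 0) ∧
    (∀ r, gaussU' τ γ n (x₂ / x₁) β₁ r r = 1) ∧
    (∀ r s, s < r → gaussU' τ γ n (x₂ / x₁) β₁ r s = 0) ∧
    (∀ R : Matrix (Fin (n + 1)) (Fin (n + 1)) ℂ,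
      IsRMatrix21 τ γ n x₁ x₂ β₁ β₂ R ↔
        R = gaussL' τ γ n (x₂ / x₁) β₂ * gaussD' τ γ n (x₂ / x₁) β₁ β₂ *
          gaussU' τ γ n (x₂ / x₁) β₁) := by
  have ha0 := qpow_ne_zero τ γ
  have hx0 : x₂ / x₁ ≠ 0 := div_ne_zero hx₂ hx₁
  have hpow : ∀ k : ℕ, 1 ≤ k → k ≤ n → qpow τ γ ^ k ≠ 1 := fun k h1 h2 => by
    rw [← qpow_nat_mul]
    exact hγ k h1 h2
  have hlt : ∀ i j : ℕ, j ≤ n → i < j → qpow τ γ ^ i ≠ qpow τ γ ^ j := fun i j hj hij h => by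
    refine hpow (j - i) (by omega) (by omega) ?_
    rw [pow_sub₀ _ ha0 hij.le, ← h, mul_inv_cancel₀ (pow_ne_zero _ ha0)]
  have hinj : ∀ i j : ℕ, i ≤ n → j ≤ n → qpow τ γ ^ i = qpow τ γ ^ j → i = j := by
    intro i j hi hj h
    rcases lt_trichotomy i j with hij | hij | hij
    · exact absurd h (hlt i j hj hij)
    · exact hij
    · exact absurd h.symm (hlt j i hi hij)
  have hP : ∀ i ≤ n, qPoch (qpow τ γ) (qpow τ γ) i ≠ 0 := fun i hi =>
    qPoch_ne_zero fun l hl => by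
      rw [← pow_succ]
      exact hpow _ (by omega) (by omega)
  have hx' : ∀ i j, i < n → j < n → x₂ / x₁ * qpow τ γ ^ i ≠ qpow τ γ ^ j := by
    intro i j hi hj h
    apply hx ((j : ℤ) - i) (by rw [abs_lt]; omega)
    rw [qpow_int_mul, zpow_sub₀ ha0, zpow_natCast, zpow_natCast, ← h,
      mul_div_cancel_right₀ _ (pow_ne_zero _ ha0)]
  have hβ' : ∀ i < n, x₂ / x₁ ≠ qpow τ β₂ * qpow τ γ ^ i := fun i hi => by
    rw [← qpow_add_nat_mul]
    exact hβ i hi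
  have hdiv : ∀ z : ℂ, z / x₁ / (x₂ / x₁) = z / x₂ := fun z => by field_simp
  have hdec : ∀ (s : Fin (n + 1)) (z : ℂ), _ := fun s z =>
    sum_qPoch_mul_gauss τ γ β₁ β₂ (z / x₁) hx0 hP hx' hβ' s
  simp only [mul_div_assoc, hdiv] at hdec
  refine ⟨fun r => ?_, fun r s hrs => ?_, fun r => ?_, fun r s hrs => ?_, fun R => ?_⟩
  · rw [gaussL'_apply τ γ (x₂ / x₁) β₂ r r (add_zero _).symm (show n = r + (n - r) by omega),
      gaussBinom_zero_left (hP _ (Nat.sub_le _ _))]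
    simp [qPoch_zero]
  · simp [gaussL', hrs]
  · simp [gaussU', qPoch_zero, qpow_zero, hP r (Nat.lt_succ_iff.1 r.isLt)]
  · simp [gaussU', hrs]
  · rw [isRMatrix21_iff τ γ β₁ β₂ hx₁ hx₂ hinj]
    simp only [mul_div_assoc]
    constructor
    · intro h
      ext r s
      rw [← sub_eq_zero]
      -- Here `u = q^β₂ / x`, so the condition `a^i u ≠ 1` is the genericity assumption on `x` and
      -- `β₂`; the variable is `w = z/x₁`.
      refine eq_zero_of_sum_qPoch_eq_zero (u := qpow τ β₂ * (x₁ / x₂)) ha0 hinj (fun i hi h1 => ?_)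
        (fun r => R r s - (gaussL' τ γ n (x₂ / x₁) β₂ * gaussD' τ γ n (x₂ / x₁) β₁ β₂ *
          gaussU' τ γ n (x₂ / x₁) β₁) r s) (fun w => ?_) r
      · apply hβ' i hi
        rw [div_eq_iff hx₁]
        have : x₂ * (qpow τ γ ^ i * (qpow τ β₂ * (x₁ / x₂))) = x₂ := by rw [h1, mul_one]
        rw [← this]
        field_simp
      · have h1 := h s (w * x₁)
        rw [← hdec s (w * x₁)] at h1
        rw [← sub_eq_zero, ← Finset.sum_sub_distrib] at h1
        rw [← h1]
        refine Finset.sum_congr rfl fun r _ => ?_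
        rw [← mul_sub, mul_div_cancel_right₀ _ hx₁,
          show qpow τ β₂ * (x₁ / x₂) * w = qpow τ β₂ * (w * x₁ / x₂) by ring]
    · rintro rfl s z
      exact hdec s z
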